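/- Let $n\ge 2$ and let $K\subset\mathbb{R}^n$ be a convex body of class $C^2_+$ (that is, its boundary is of class $C^2$ with everywhere positive Gauss curvature) containing the origin in its interior. Let $\nu$ be the outer unit normal (Gauss map) of $\partial K$, $\kappa$ its Gauss curvature, $h(u)=\max_{x\in K} x\cdot u$ the support function of $K$, and let $\kappa_0(x)=\kappa(x)/h(\nu(x))^{n+1}$ be the centro-affine curvature at $x\in\partial K$. Let $\mu_K$ be the cone measure of $\partial K$, $\mu_K(A)=n\,\mathrm{Vol}\{tx: x\in A,\ 0\le t\le 1\}$, and for real $q\neq -n$ let $\Omega_q(K)=\int_{\partial K}\kappa_0^{\,q/(n+q)}\,d\mu_K$ be the $q$-affine surface area. Put $$\Lambda(K):=\exp\left[\frac{1}{n\,\mathrm{Vol}(K)}\int_{\partial K}\ln\kappa_0\,d\mu_K\right].$$ Then the integrals defining $\Lambda(K)$ and $\Omega_{-n/2^p}(K)$ ($p\in\mathbb{N}$, $p>1$) converge. Moreover, $\Lambda$ is an $SL(n)$-invariant: for every linear map $T$ of determinant $1$, $TK$ is again a convex body of class $C^2_+$ containing the origin in its interior, and $\Lambda(TK)=\Lambda(K)$.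 Finally, $$\lim_{p\to\infty}\left(\frac{\Omega_{-n/2^p}(K)}{n\,\mathrm{Vol}(K)}\right)^{2^p}=\Lambda(K)^{-1},$$ where $p$ runs through the integers $p>1$; equivalently, $\Lambda(K)$ is the limit of $\left(\frac{n\,\mathrm{Vol}(K)}{\Omega_{-n/2^p}(K)}\right)^{2^p}$. -/

import Mathlib

open MeasureTheory Filter Topology

noncomputable section

namespace CentroAffine

variable {n : ℕ}

/-- The support function `h_K(u) = max {x · u | x ∈ K}`. -/
def supportFunction (K : Set (EuclideanSpace ℝ (Fin n))) (u : EuclideanSpace ℝ (Fin n)) : ℝ :=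
  sSup ((fun x => inner ℝ x u) '' K)

/-- `u` is an outer unit normal vector of `K` at `x`. -/
def IsOuterUnitNormal (K : Set (EuclideanSpace ℝ (Fin n))) (x u : EuclideanSpace ℝ (Fin n)) :
    Prop :=
  ‖u‖ = 1 ∧ ∀ y ∈ K, inner ℝ (y - x) u ≤ 0

/-- The Gauss map `ν : ∂K → S^{n-1}`. It is the outer unit normal vector at `x`, which is unique
at each boundary point of a convex body whose boundary is differentiable; only its values on
`∂K` are ever used. -/
def gaussMap (K : Set (EuclideanSpace ℝ (Fin n))) (x : EuclideanSpace ℝ (Fin n)) :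
    EuclideanSpace ℝ (Fin n) :=
  Classical.epsilon (IsOuterUnitNormal K x)

/-- The tangent hyperplane `T_x ∂K = ν(x)^⊥`, as a linear subspace. -/
def tangentPlane (K : Set (EuclideanSpace ℝ (Fin n))) (x : EuclideanSpace ℝ (Fin n)) :
    Submodule ℝ (EuclideanSpace ℝ (Fin n)) :=
  (Submodule.span ℝ {gaussMap K x})ᗮ

/-- The shape operator (Weingarten map) `dν_x : T_x ∂K → T_x ∂K`, the differential of the Gauss
map along `∂K`. The values of `fderivWithin` on tangent vectors of `∂K` do not depend on the choice
of a derivative of `ν` within `∂K`, and the differential of `ν` already has its values in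
`T_x ∂K`; the orthogonal projection only adjusts the codomain. -/
def shapeOperator (K : Set (EuclideanSpace ℝ (Fin n))) (x : EuclideanSpace ℝ (Fin n)) :
    tangentPlane K x →ₗ[ℝ] tangentPlane K x :=
  ((tangentPlane K x).orthogonalProjectionOnto.comp
    ((fderivWithin ℝ (gaussMap K) (frontier K) x).comp (tangentPlane K x).subtypeL)).toLinearMap

/-- The Gauss curvature of `∂K` at the boundary point `x`. -/
def gaussCurvature (K : Set (EuclideanSpace ℝ (Fin n))) (x : EuclideanSpace ℝ (Fin n)) : ℝ :=
  LinearMap.det (shapeOperator K x)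

/-- The boundary of `K` is of class `C²`: near each of its boundary points, `K` is the sublevel
set of a `C²` function with nonvanishing differential. -/
def HasC2Boundary (K : Set (EuclideanSpace ℝ (Fin n))) : Prop :=
  ∀ x ∈ frontier K, ∃ f : EuclideanSpace ℝ (Fin n) → ℝ,
    ContDiffAt ℝ 2 f x ∧ fderiv ℝ f x ≠ 0 ∧ ∀ᶠ y in 𝓝 x, (y ∈ K ↔ f y ≤ 0)

/-- Convex bodies of class `C²₊` (boundary of class `C²` with positive Gauss curvature) that
contain the origin in their interior. -/
structure IsC2PlusBody (K : Set (EuclideanSpace ℝ (Fin n))) : Prop where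
  convex : Convex ℝ K
  isCompact : IsCompact K
  zero_mem_interior : (0 : EuclideanSpace ℝ (Fin n)) ∈ interior K
  c2_boundary : HasC2Boundary K
  gaussCurvature_pos : ∀ x ∈ frontier K, 0 < gaussCurvature K x

/-- The centro-affine curvature `κ₀ = κ / h^{n+1}` at the boundary point `x`, the support
function being taken at the normal `ν(x)`. -/
def centroAffineCurvature (K : Set (EuclideanSpace ℝ (Fin n)))
    (x : EuclideanSpace ℝ (Fin n)) : ℝ :=
  gaussCurvature K x / supportFunction K (gaussMap K x) ^ (n + 1)

/-- The radial projection of `ℝⁿ \ {0}` onto `∂K`, where `gauge K` is the Minkowski functional. -/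
def radialProjection (K : Set (EuclideanSpace ℝ (Fin n))) (x : EuclideanSpace ℝ (Fin n)) :
    EuclideanSpace ℝ (Fin n) :=
  (gauge K x)⁻¹ • x

/-- The cone measure of `∂K`, normalized to total mass `n Vol(K)`: for a Borel set `A ⊆ ∂K`,
`μ_K(A) = n Vol {t x | x ∈ A, 0 ≤ t ≤ 1}`. The cone over `A` is, up to the origin, the set of
points of `K` whose radial projection lies in `A`. -/
def coneMeasure (K : Set (EuclideanSpace ℝ (Fin n))) : Measure (EuclideanSpace ℝ (Fin n)) :=
  (n : ENNReal) • Measure.map (radialProjection K) (volume.restrict K)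

/-- The `q`-affine surface area `Ω_q(K) = ∫_{∂K} κ₀^{q/(n+q)} dμ_K`. -/
def affineSurfaceArea (q : ℝ) (K : Set (EuclideanSpace ℝ (Fin n))) : ℝ :=
  ∫ x in frontier K, centroAffineCurvature K x ^ (q / (n + q)) ∂(coneMeasure K)

/-- `Λ(K) = exp[(1 / (n Vol K)) ∫_{∂K} ln κ₀ dμ_K]`. -/
def Lam (K : Set (EuclideanSpace ℝ (Fin n))) : ℝ :=
  Real.exp (1 / (n * volume.real K) *
    ∫ x in frontier K, Real.log (centroAffineCurvature K x) ∂(coneMeasure K))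

end CentroAffine

end

/-!
The whole statement rests on one formula for the centro-affine curvature. Near a boundary point
`x`, let `K` be the sublevel set `{f ≤ 0}` of a `C²` function with gradient `g ≠ 0` and Hessian `H`
at `x`. The outer unit normal is `g / ‖g‖`, so the shape operator is the compression of `H / ‖g‖` to
`g^⊥`. Since a perturbation of `H` by a multiple of the projection to `g` changes its determinant by
a multiple of the determinant of this compression (`det_add_smul_rankOne_sub_det`), the Gauss
curvature `κ` satisfies `κ ‖g‖ ^ (n + 1) = det (H + g ⊗ g) - det H`
(`IsLocalDefiningFunction.gaussCurvature_mul`). The support function at the normal is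
`⟪x, g⟫ / ‖g‖`, hence
`κ₀ = (det (H + g ⊗ g) - det H) / ⟪x, g⟫ ^ (n + 1)`
(`IsLocalDefiningFunction.centroAffineCurvature_eq`).

The right-hand side is continuous in `x`, so `κ₀` is continuous and positive on the compact set
`∂K`. As the cone measure is finite, the integrals of `ln κ₀` and of the powers of `κ₀` converge.
For `T ∈ SL(n)` the body `TK` has the local defining function `f ∘ T⁻¹`; its gradient is `T⁻* g` and
its Hessian `T⁻* H T⁻¹`, which leaves both numerator and denominator unchanged. Because `T` also
carries the cone measure of `K` to that of `TK` (`coneMeasure_image`), `Λ` is invariant.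

For `q = -n / N` with `N = 2 ^ p` the exponent `q / (n + q)` equals `-1 / (N - 1)`. The cone measure
has mass `n Vol(K)` on `∂K`, so `(Ω_q / (n Vol(K))) ^ N` is, up to the exponent `N / (N - 1) → 1`,
the mean of `κ₀` of order `-1 / (N - 1)` to the power `-1`; as the order tends to zero the mean
tends to the geometric mean `Λ(K)` (`tendsto_integral_exp_div_pow`).
-/

open MeasureTheory Filter Topology

noncomputable section

namespace CentroAffine

variable {n : ℕ}

/-! ### Rank-one perturbations of determinants -/

section LinearAlgebra

open InnerProductSpace Module

variable {E : Type*} [NormedAddCommGroup E] [InnerProductSpace ℝ E] [FiniteDimensional ℝ E]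

/-- The compression of an endomorphism `A` to the hyperplane `u^⊥`. -/
def compression (u : E) (A : E →L[ℝ] E) : (Submodule.span ℝ {u})ᗮ →ₗ[ℝ] (Submodule.span ℝ {u})ᗮ :=
  ((Submodule.span ℝ {u})ᗮ.orthogonalProjectionOnto.comp
    (A.comp (Submodule.span ℝ {u})ᗮ.subtypeL)).toLinearMap

lemma exists_orthonormalBasis_cons {u : E} (hu : ‖u‖ = 1) :
    ∃ (m : ℕ) (b : OrthonormalBasis (Fin m) ℝ (Submodule.span ℝ {u})ᗮ)
      (c : OrthonormalBasis (Fin (m + 1)) ℝ E),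
      m + 1 = finrank ℝ E ∧ c 0 = u ∧ ∀ i, c i.succ = b i := by
  have hu0 : u ≠ 0 := by rintro rfl; simp at hu
  have hdim : finrank ℝ (Submodule.span ℝ {u})ᗮ + 1 = finrank ℝ E := by
    rw [← (Submodule.span ℝ {u}).finrank_add_finrank_orthogonal, finrank_span_singleton hu0,
      add_comm]
  let b := stdOrthonormalBasis ℝ (Submodule.span ℝ {u})ᗮ
  let v : Fin (finrank ℝ (Submodule.span ℝ {u})ᗮ + 1) → E := Fin.cons u fun i => (b i : E)
  have hub (i) : inner ℝ u (b i : E) = 0 :=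
    Submodule.mem_orthogonal_singleton_iff_inner_right.1 (b i).2
  have hv : Orthonormal ℝ v := by
    rw [orthonormal_iff_ite]
    intro i j
    refine Fin.cases ?_ (fun i => ?_) i <;> refine Fin.cases ?_ (fun j => ?_) j
    · simp [v, hu]
    · simpa [v, (Fin.succ_ne_zero j).symm] using hub j
    · simpa [v, real_inner_comm] using hub i
    · have := orthonormal_iff_ite.1 b.orthonormal i j
      simpa [v] using this
  have hc := coe_basisOfOrthonormalOfCardEqFinrank hv (by simpa using hdim)
  refine ⟨_, b, (basisOfOrthonormalOfCardEqFinrank hv (by simpa using hdim)).toOrthonormalBasis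
    (by rwa [hc]), hdim, ?_, fun i => ?_⟩
  · rw [Basis.coe_toOrthonormalBasis, hc]; rfl
  · rw [Basis.coe_toOrthonormalBasis, hc]; rfl

/-- Expanding along the `u`-row of an orthonormal basis adapted to `u`, a perturbation by a
multiple of the projection to `u` changes the determinant by a multiple of the minor complementary
to `u`. -/
lemma det_add_smul_rankOne_sub_det {u : E} (hu : ‖u‖ = 1) (A : E →L[ℝ] E) (t : ℝ) :
    LinearMap.det (A + t • rankOne ℝ u u).toLinearMap - LinearMap.det A.toLinearMap =
      t * LinearMap.det (compression u A) := by
  obtain ⟨m, b, c, -, hc0, hcs⟩ := exists_orthonormalBasis_cons hu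
  rw [← LinearMap.det_toMatrix c.toBasis, ← LinearMap.det_toMatrix c.toBasis,
    ← LinearMap.det_toMatrix b.toBasis, Matrix.det_succ_row_zero, Matrix.det_succ_row_zero,
    ← Finset.sum_sub_distrib]
  have hu' (i : Fin m) : inner ℝ u (b i : E) = 0 :=
    Submodule.mem_orthogonal_singleton_iff_inner_right.1 (b i).2
  have hu'' (i : Fin m) : inner ℝ (b i : E) u = 0 := by rw [real_inner_comm, hu']
  have huu : inner ℝ u u = (1 : ℝ) := by simp [hu]
  have hsub (j : Fin (m + 1)) :
      ((LinearMap.toMatrix c.toBasis c.toBasis) (A + t • rankOne ℝ u u).toLinearMap).submatrix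
        Fin.succ j.succAbove =
      ((LinearMap.toMatrix c.toBasis c.toBasis) A.toLinearMap).submatrix Fin.succ j.succAbove := by
    ext i k
    simp [LinearMap.toMatrix_apply, c.repr_apply_apply, hcs, hu'']
  rw [Fin.sum_univ_succ, Finset.sum_eq_zero, add_zero, hsub]
  · have : ((LinearMap.toMatrix c.toBasis c.toBasis) A.toLinearMap).submatrix Fin.succ
        (Fin.succAbove 0) = LinearMap.toMatrix b.toBasis b.toBasis (compression u A) := by
      ext i k
      simp [LinearMap.toMatrix_apply, c.repr_apply_apply, b.repr_apply_apply, hcs, compression]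
    rw [this]
    simp [LinearMap.toMatrix_apply, c.repr_apply_apply, hc0, hu]
    ring
  · intro j _
    rw [hsub]
    simp [LinearMap.toMatrix_apply, c.repr_apply_apply, hc0, hcs, hu']

lemma finrank_orthogonal_span_singleton_add_one {u : E} (hu : ‖u‖ = 1) :
    finrank ℝ (Submodule.span ℝ {u})ᗮ + 1 = finrank ℝ E := by
  obtain ⟨m, b, -, hm, -⟩ := exists_orthonormalBasis_cons hu
  rw [← hm, finrank_eq_card_basis b.toBasis, Fintype.card_fin]

end LinearAlgebra

/-! ### Local defining functions and the Gauss map -/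

section LocalDefiningFunction

open InnerProductSpace Module

variable {K : Set (EuclideanSpace ℝ (Fin n))} {f : EuclideanSpace ℝ (Fin n) → ℝ}
  {x u : EuclideanSpace ℝ (Fin n)}

/-- Near `x`, the set `K` is the sublevel set `{f ≤ 0}` of a `C²` function with nonzero
gradient. -/
structure IsLocalDefiningFunction (K : Set (EuclideanSpace ℝ (Fin n)))
    (f : EuclideanSpace ℝ (Fin n) → ℝ) (x : EuclideanSpace ℝ (Fin n)) : Prop where
  contDiffAt : ContDiffAt ℝ 2 f x
  gradient_ne_zero : gradient f x ≠ 0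
  mem_iff : ∀ᶠ y in 𝓝 x, (y ∈ K ↔ f y ≤ 0)

lemma gradient_ne_zero_iff : gradient f x ≠ 0 ↔ fderiv ℝ f x ≠ 0 := by
  simp [gradient]

lemma HasC2Boundary.exists_isLocalDefiningFunction (hK : HasC2Boundary K) (hx : x ∈ frontier K) :
    ∃ f, IsLocalDefiningFunction K f x := by
  obtain ⟨f, h1, h2, h3⟩ := hK x hx
  exact ⟨f, h1, gradient_ne_zero_iff.2 h2, h3⟩

lemma contDiffAt_gradient (hf : ContDiffAt ℝ 2 f x) : ContDiffAt ℝ 1 (gradient f) x :=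
  (toDual ℝ (EuclideanSpace ℝ (Fin n))).symm.contDiff.contDiffAt.comp x
    (hf.fderiv_right (m := 1) (by norm_num))

namespace IsLocalDefiningFunction

lemma eventually (h : IsLocalDefiningFunction K f x) :
    ∀ᶠ y in 𝓝 x, IsLocalDefiningFunction K f y := by
  filter_upwards [h.contDiffAt.eventually (by simp), h.mem_iff.eventually_nhds,
    (contDiffAt_gradient h.contDiffAt).continuousAt.eventually_ne h.gradient_ne_zero]
    with y h1 h2 h3 using ⟨h1, h3, h2⟩

lemma hasFDerivAt (h : IsLocalDefiningFunction K f x) :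
    HasFDerivAt f (fderiv ℝ f x) x :=
  (h.contDiffAt.differentiableAt (by norm_num)).hasFDerivAt

lemma eq_zero (h : IsLocalDefiningFunction K f x) (hK : IsClosed K) (hx : x ∈ frontier K) :
    f x = 0 := by
  refine le_antisymm (h.mem_iff.self_of_nhds.1 (hK.frontier_subset hx)) ?_
  by_contra! hlt
  refine hx.2 (mem_interior_iff_mem_nhds.2 ?_)
  filter_upwards [h.mem_iff, h.contDiffAt.continuousAt.eventually_lt continuousAt_const hlt]
    with y h1 h2 using h1.2 h2.le

lemma mem_frontier (h : IsLocalDefiningFunction K f x) (hx : f x = 0) : x ∈ frontier K := by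
  refine ⟨subset_closure (h.mem_iff.self_of_nhds.2 hx.le), fun hi => ?_⟩
  have hmax : IsLocalMax f x := by
    filter_upwards [h.mem_iff, mem_interior_iff_mem_nhds.1 hi] with y h1 h2
    rw [hx]; exact h1.1 h2
  exact gradient_ne_zero_iff.1 h.gradient_ne_zero hmax.fderiv_eq_zero

/-- Along a ray in the direction `v`, the sign of `⟪∇f(x), v⟫` decides whether the ray enters
`K`. -/
lemma eventually_mem (h : IsLocalDefiningFunction K f x) (hx : f x = 0)
    {v : EuclideanSpace ℝ (Fin n)} (hv : inner ℝ (gradient f x) v < 0) :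
    ∀ᶠ t : ℝ in 𝓝[>] 0, x + t • v ∈ K := by
  have hd : HasDerivAt (fun t : ℝ => f (x + t • v)) (inner ℝ (gradient f x) v) 0 := by
    rw [inner_gradient_left]
    exact h.hasFDerivAt.hasLineDerivAt v
  have hc : Tendsto (fun t : ℝ => x + t • v) (𝓝 0) (𝓝 x) := by
    have : Continuous fun t : ℝ => x + t • v := by fun_prop
    simpa using this.tendsto 0
  have hs := (hasDerivAt_iff_tendsto_slope_zero.1 hd).eventually_lt_const hv
  filter_upwards [(nhdsGT_le_nhdsNE 0) hs, nhdsWithin_le_nhds (hc.eventually h.mem_iff),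
    self_mem_nhdsWithin] with t h1 h2 h3
  have ht : (0 : ℝ) < t := h3
  refine h2.2 ?_
  simp only [zero_add, zero_smul, add_zero, hx, sub_zero, smul_eq_mul] at h1
  have := mul_neg_of_pos_of_neg ht h1
  rw [mul_inv_cancel_left₀ ht.ne'] at this
  exact this.le

lemma inner_gradient_sub_nonpos (h : IsLocalDefiningFunction K f x) (hx : f x = 0)
    (hK : Convex ℝ K) {y : EuclideanSpace ℝ (Fin n)} (hy : y ∈ K) :
    inner ℝ (gradient f x) (y - x) ≤ 0 := by
  have hd : HasDerivAt (fun t : ℝ => f (x + t • (y - x))) (inner ℝ (gradient f x) (y - x)) 0 := by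
    rw [inner_gradient_left]
    exact h.hasFDerivAt.hasLineDerivAt _
  have hc : Tendsto (fun t : ℝ => x + t • (y - x)) (𝓝 0) (𝓝 x) := by
    have : Continuous fun t : ℝ => x + t • (y - x) := by fun_prop
    simpa using this.tendsto 0
  have hs := (hasDerivAt_iff_tendsto_slope_zero.1 hd).mono_left (nhdsGT_le_nhdsNE 0)
  refine le_of_tendsto hs ?_
  filter_upwards [nhdsWithin_le_nhds (hc.eventually h.mem_iff),
    Ioo_mem_nhdsGT (zero_lt_one' ℝ)] with t h2 h3
  have hxK : x ∈ K := h.mem_iff.self_of_nhds.2 hx.le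
  have := h2.1 (hK.add_smul_sub_mem hxK hy ⟨h3.1.le, h3.2.le⟩)
  simp only [zero_add, zero_smul, add_zero, hx, sub_zero, smul_eq_mul]
  exact mul_nonpos_of_nonneg_of_nonpos (inv_nonneg.2 h3.1.le) this

lemma isOuterUnitNormal (h : IsLocalDefiningFunction K f x) (hx : f x = 0) (hK : Convex ℝ K) :
    IsOuterUnitNormal K x (‖gradient f x‖⁻¹ • gradient f x) := by
  refine ⟨norm_smul_inv_norm h.gradient_ne_zero, fun y hy => ?_⟩
  rw [inner_smul_right, real_inner_comm]
  exact mul_nonpos_of_nonneg_of_nonpos (by positivity) (h.inner_gradient_sub_nonpos hx hK hy)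

/-- A boundary point with a local defining function has only one outer unit normal: the
half-space polar to it contains the half-space polar to the gradient. -/
lemma eq_of_isOuterUnitNormal (h : IsLocalDefiningFunction K f x) (hx : f x = 0)
    (hu : IsOuterUnitNormal K x u) : u = ‖gradient f x‖⁻¹ • gradient f x := by
  set g := gradient f x with hg
  have hg0 : g ≠ 0 := h.gradient_ne_zero
  have hgpos : 0 < ‖g‖ := norm_pos_iff.2 hg0
  have key (v) (hv : inner ℝ g v < 0) : inner ℝ v u ≤ 0 := by
    obtain ⟨t, h1, h2⟩ := ((h.eventually_mem hx hv).and self_mem_nhdsWithin).exists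
    have h3 := hu.2 _ h1
    rw [add_sub_cancel_left, real_inner_smul_left] at h3
    exact nonpos_of_mul_nonpos_right h3 h2
  have key' (v) (hv : inner ℝ g v ≤ 0) : inner ℝ v u ≤ 0 := by
    have hc : Tendsto (fun t : ℝ => inner ℝ (v - t • g) u) (𝓝[>] 0) (𝓝 (inner ℝ v u)) := by
      have : Continuous fun t : ℝ => inner ℝ (v - t • g) u := by fun_prop
      simpa using (this.tendsto 0).mono_left nhdsWithin_le_nhds
    refine le_of_tendsto hc ?_
    filter_upwards [self_mem_nhdsWithin] with t ht
    refine key _ ?_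
    rw [inner_sub_right, inner_smul_right, real_inner_self_eq_norm_sq]
    have : 0 < t * ‖g‖ ^ 2 := mul_pos ht (by positivity)
    linarith
  set a := inner ℝ g u / ‖g‖ ^ 2 with ha
  have hort : inner ℝ g (u - a • g) = 0 := by
    rw [inner_sub_right, inner_smul_right, real_inner_self_eq_norm_sq, ha]
    field_simp
    ring
  -- the component of `u` orthogonal to the gradient has nonpositive inner product with `u`
  have hu0 : u - a • g = 0 := by
    have h1 := key' _ hort.le
    have h2 : inner ℝ (u - a • g) u = ‖u - a • g‖ ^ 2 := by
      have : inner ℝ (u - a • g) (a • g) = 0 := by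
        rw [inner_smul_right, real_inner_comm, hort, mul_zero]
      rw [← real_inner_self_eq_norm_sq, inner_sub_right (u - a • g) u, this, sub_zero]
    rw [h2] at h1
    exact norm_eq_zero.1 (pow_eq_zero_iff two_ne_zero |>.1 (le_antisymm h1 (by positivity)))
  have hua : u = a • g := sub_eq_zero.1 hu0
  have ha0 : 0 ≤ a := by
    have := key' (-g) (by rw [inner_neg_right, real_inner_self_eq_norm_sq]; simp)
    rw [inner_neg_left] at this
    rw [ha]
    exact div_nonneg (by linarith) (by positivity)
  have h1 : a * ‖g‖ = 1 := by
    have := hu.1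
    rwa [hua, norm_smul, Real.norm_of_nonneg ha0] at this
  rw [hua, eq_inv_of_mul_eq_one_left h1]

lemma gaussMap_eq (h : IsLocalDefiningFunction K f x) (hx : f x = 0) (hK : Convex ℝ K) :
    gaussMap K x = ‖gradient f x‖⁻¹ • gradient f x :=
  h.eq_of_isOuterUnitNormal hx (Classical.epsilon_spec ⟨_, h.isOuterUnitNormal hx hK⟩)

/-- The boundary of `K` has a curve through `x` in each direction orthogonal to the gradient, by
the implicit function theorem. -/
lemma mem_tangentConeAt_frontier (h : IsLocalDefiningFunction K f x) (hx : f x = 0)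
    {v : EuclideanSpace ℝ (Fin n)} (hv : inner ℝ (gradient f x) v = 0) :
    v ∈ tangentConeAt ℝ (frontier K) x := by
  have hf : HasStrictFDerivAt f (fderiv ℝ f x) x :=
    h.contDiffAt.hasStrictFDerivAt (by norm_num)
  have hsurj : (fderiv ℝ f x).range = ⊤ :=
    LinearMap.range_eq_top.2 (LinearMap.surjective fun h0 =>
      gradient_ne_zero_iff.1 h.gradient_ne_zero (ContinuousLinearMap.coe_injective h0))
  rw [inner_gradient_left] at hv
  let w : (fderiv ℝ f x).ker := ⟨v, hv⟩
  let γ : ℝ → EuclideanSpace ℝ (Fin n) := fun t => hf.implicitFunction _ _ hsurj (f x) (t • w)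
  have hγ0 : γ 0 = x := by simp [γ]
  have hγ : HasDerivAt γ v 0 := by
    have h1 : HasDerivAt (fun t : ℝ => t • w) w 0 := by
      simpa using (hasDerivAt_id (0 : ℝ)).smul_const w
    have h2 := (hf.to_implicitFunction hsurj).hasFDerivAt
    exact HasFDerivAt.comp_hasDerivAt (f := fun t : ℝ => t • w) (0 : ℝ) (by simpa using h2) h1
  have hγc : Tendsto γ (𝓝[≠] 0) (𝓝 x) := by
    have := hγ.continuousAt.tendsto
    rw [hγ0] at this
    exact this.mono_left nhdsWithin_le_nhds
  have hw : Tendsto (fun t : ℝ => (f x, t • w)) (𝓝[≠] 0) (𝓝 (f x, 0)) := by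
    have : Continuous fun t : ℝ => (f x, t • w) := by fun_prop
    simpa using (this.tendsto 0).mono_left nhdsWithin_le_nhds
  refine mem_tangentConeAt_of_seq (𝓝[≠] (0 : ℝ)) (fun t => t⁻¹) (fun t => γ t - x) ?_ ?_ ?_
  · simpa using hγc.sub_const x
  · filter_upwards [hγc.eventually h.eventually,
      hw.eventually (hf.map_implicitFunction_eq hsurj)] with t h1 h2
    rw [add_sub_cancel]
    exact h1.mem_frontier (h2.trans hx)
  · simpa [hγ0] using hasDerivAt_iff_tendsto_slope_zero.1 hγ

end IsLocalDefiningFunction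

end LocalDefiningFunction

/-! ### Curvature in terms of a local defining function -/

section Curvature

open InnerProductSpace Module

variable {K : Set (EuclideanSpace ℝ (Fin n))} {f : EuclideanSpace ℝ (Fin n) → ℝ}
  {x : EuclideanSpace ℝ (Fin n)}

/-- For `g = ∇f(x)` and `H = D²f(x)`, the number `det (H + g ⊗ g) - det H`. It is the negative of
the determinant of the Hessian bordered by the gradient, written without coordinates. -/
def borderedHessian (f : EuclideanSpace ℝ (Fin n) → ℝ) (x : EuclideanSpace ℝ (Fin n)) : ℝ :=
  LinearMap.det (fderiv ℝ (gradient f) x + rankOne ℝ (gradient f x) (gradient f x)).toLinearMap -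
    LinearMap.det (fderiv ℝ (gradient f) x).toLinearMap

lemma continuousAt_borderedHessian (hf : ContDiffAt ℝ 2 f x) :
    ContinuousAt (borderedHessian f) x := by
  have h1 : ContinuousAt (fderiv ℝ (gradient f)) x :=
    ((contDiffAt_gradient hf).fderiv_right (m := 0) (by norm_num)).continuousAt
  have h2 : ContinuousAt (gradient f) x := (contDiffAt_gradient hf).continuousAt
  have h3 : ContinuousAt (fun y => rankOne ℝ (gradient f y) (gradient f y)) x :=
    ((rankOne ℝ).continuous.continuousAt.comp h2).clm_apply h2
  exact (ContinuousLinearMap.continuous_det.continuousAt.comp (h1.add h3)).sub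
    (ContinuousLinearMap.continuous_det.continuousAt.comp h1)

/-- The derivative of the unit normal field `∇f / ‖∇f‖`, up to multiples of the normal. -/
lemma fderiv_normalize_gradient (hf : ContDiffAt ℝ 2 f x) (hg : gradient f x ≠ 0) :
    ∃ c : EuclideanSpace ℝ (Fin n) → ℝ,
      DifferentiableAt ℝ (fun y => ‖gradient f y‖⁻¹ • gradient f y) x ∧
      ∀ v, fderiv ℝ (fun y => ‖gradient f y‖⁻¹ • gradient f y) x v =
        ‖gradient f x‖⁻¹ • fderiv ℝ (gradient f) x v + c v • gradient f x := by
  have h1 : DifferentiableAt ℝ (gradient f) x :=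
    (contDiffAt_gradient hf).differentiableAt (by norm_num)
  have h2 : DifferentiableAt ℝ (fun y => ‖gradient f y‖⁻¹) x :=
    (h1.norm ℝ hg).inv (norm_ne_zero_iff.2 hg)
  refine ⟨fderiv ℝ (fun y => ‖gradient f y‖⁻¹) x, h2.smul h1, fun v => ?_⟩
  rw [fderiv_fun_smul h2 h1]
  simp

/-- The Gauss curvature is `(det (H + g ⊗ g) - det H) / ‖g‖ ^ (n + 1)`, where `g` is the gradient
and `H` the Hessian of a local defining function. -/
lemma IsLocalDefiningFunction.gaussCurvature_mul (h : IsLocalDefiningFunction K f x)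
    (hx : f x = 0) (hKc : Convex ℝ K) (hK : IsClosed K) :
    gaussCurvature K x * ‖gradient f x‖ ^ (n + 1) = borderedHessian f x := by
  set g := gradient f x with hg
  set H := fderiv ℝ (gradient f) x with hH
  have hg0 : g ≠ 0 := h.gradient_ne_zero
  have hgn : ‖g‖ ≠ 0 := norm_ne_zero_iff.2 hg0
  set u := gaussMap K x with hu
  have hug : u = ‖g‖⁻¹ • g := h.gaussMap_eq hx hKc
  have hgu : g = ‖g‖ • u := by rw [hug, smul_inv_smul₀ hgn]
  have hu1 : ‖u‖ = 1 := by rw [hug]; exact norm_smul_inv_norm hg0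
  obtain ⟨c, hdiff, hc⟩ := fderiv_normalize_gradient h.contDiffAt hg0
  have hxf : x ∈ frontier K := h.mem_frontier hx
  -- within the boundary, the Gauss map is the normalized gradient
  have heq : gaussMap K =ᶠ[𝓝[frontier K] x] fun y => ‖gradient f y‖⁻¹ • gradient f y := by
    filter_upwards [self_mem_nhdsWithin, nhdsWithin_le_nhds h.eventually] with y hy h1
    exact h1.gaussMap_eq (h1.eq_zero hK hy) hKc
  have hN : HasFDerivWithinAt (gaussMap K)
      (fderiv ℝ (fun y => ‖gradient f y‖⁻¹ • gradient f y) x) (frontier K) x :=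
    hdiff.hasFDerivAt.hasFDerivWithinAt.congr_of_eventuallyEq heq (heq.self_of_nhdsWithin hxf)
  have hfd (v) (hv : inner ℝ g v = 0) : fderivWithin ℝ (gaussMap K) (frontier K) x v =
      ‖g‖⁻¹ • H v + c v • g := by
    rw [hN.differentiableWithinAt.hasFDerivWithinAt.unique_on hN
      (h.mem_tangentConeAt_frontier hx hv)]
    exact hc v
  have hshape : shapeOperator K x = ‖g‖⁻¹ • compression u H := by
    ext1 v
    have hv : inner ℝ g (v : EuclideanSpace ℝ (Fin n)) = 0 := by
      rw [hgu, real_inner_smul_left, Submodule.mem_orthogonal_singleton_iff_inner_right.1 v.2,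
        mul_zero]
    have hgz : (Submodule.span ℝ {u})ᗮ.orthogonalProjectionOnto g = 0 := by
      refine Submodule.orthogonalProjectionOnto_orthogonal_apply_eq_zero ?_
      rw [hgu]
      exact Submodule.smul_mem _ _ (Submodule.mem_span_singleton_self u)
    change (Submodule.span ℝ {u})ᗮ.orthogonalProjectionOnto
        (fderivWithin ℝ (gaussMap K) (frontier K) x v) =
      ‖g‖⁻¹ • (Submodule.span ℝ {u})ᗮ.orthogonalProjectionOnto (H v)
    rw [hfd v hv, map_add, map_smul, map_smul, hgz, smul_zero, add_zero]
  have hdim : finrank ℝ (Submodule.span ℝ {u})ᗮ + 1 = n := by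
    simpa using finrank_orthogonal_span_singleton_add_one hu1
  have hrank : rankOne ℝ g g = ‖g‖ ^ 2 • rankOne ℝ u u := by
    ext1 v
    simp only [rankOne_apply, smul_apply]
    conv_lhs => rw [hgu, real_inner_smul_left]
    module
  have hcurv : gaussCurvature K x =
      ‖g‖⁻¹ ^ finrank ℝ (Submodule.span ℝ {u})ᗮ * LinearMap.det (compression u H) := by
    rw [gaussCurvature, hshape]
    exact LinearMap.det_smul _ _
  rw [borderedHessian, ← hg, ← hH, hrank, det_add_smul_rankOne_sub_det hu1, hcurv]
  have hpow : ‖g‖ ^ (n + 1) = ‖g‖ ^ finrank ℝ (Submodule.span ℝ {u})ᗮ * ‖g‖ ^ 2 := by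
    rw [← pow_add]
    congr 1
    omega
  rw [hpow, inv_pow]
  field_simp

end Curvature

/-! ### The support function at a normal vector -/

section Support

variable {K : Set (EuclideanSpace ℝ (Fin n))} {x u : EuclideanSpace ℝ (Fin n)}

lemma IsOuterUnitNormal.supportFunction_eq (hx : x ∈ K) (hu : IsOuterUnitNormal K x u) :
    supportFunction K u = inner ℝ x u := by
  have : IsGreatest ((fun x => inner ℝ x u) '' K) (inner ℝ x u) := by
    refine ⟨⟨x, hx, rfl⟩, ?_⟩
    rintro _ ⟨y, hy, rfl⟩
    have := hu.2 y hy
    rw [inner_sub_left] at this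
    exact sub_nonpos.1 this
  exact this.csSup_eq

lemma IsOuterUnitNormal.inner_pos (h0 : (0 : EuclideanSpace ℝ (Fin n)) ∈ interior K)
    (hu : IsOuterUnitNormal K x u) : 0 < inner ℝ x u := by
  obtain ⟨r, hr, hrK⟩ := Metric.mem_nhds_iff.1 (mem_interior_iff_mem_nhds.1 h0)
  have hmem : (r / 2) • u ∈ K := hrK (by
    rw [mem_ball_zero_iff, norm_smul, hu.1, Real.norm_of_nonneg (by positivity)]; linarith)
  have := hu.2 _ hmem
  rw [inner_sub_left, real_inner_smul_left, real_inner_self_eq_norm_sq, hu.1] at this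
  linarith

end Support

/-! ### Formula and continuity of the centro-affine curvature -/

section CentroAffineCurvature

variable {K : Set (EuclideanSpace ℝ (Fin n))} {f : EuclideanSpace ℝ (Fin n) → ℝ}
  {x : EuclideanSpace ℝ (Fin n)}

lemma IsLocalDefiningFunction.inner_gradient_pos (h : IsLocalDefiningFunction K f x)
    (hx : f x = 0) (hKc : Convex ℝ K) (h0 : (0 : EuclideanSpace ℝ (Fin n)) ∈ interior K) :
    0 < inner ℝ x (gradient f x) := by
  have h1 := (h.isOuterUnitNormal hx hKc).inner_pos h0
  rw [inner_smul_right] at h1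
  exact pos_of_mul_pos_right h1 (by positivity)

/-- The centro-affine curvature is `(det (H + g ⊗ g) - det H) / ⟪x, g⟫ ^ (n + 1)`. Here the
normalization of the gradient `g` has cancelled, which makes the `SL(n)`-invariance visible. -/
lemma IsLocalDefiningFunction.centroAffineCurvature_eq (h : IsLocalDefiningFunction K f x)
    (hx : f x = 0) (hKc : Convex ℝ K) (hK : IsClosed K) :
    centroAffineCurvature K x = borderedHessian f x / inner ℝ x (gradient f x) ^ (n + 1) := by
  have hg : ‖gradient f x‖ ≠ 0 := norm_ne_zero_iff.2 h.gradient_ne_zero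
  rw [← h.gaussCurvature_mul hx hKc hK, centroAffineCurvature, h.gaussMap_eq hx hKc,
    (h.isOuterUnitNormal hx hKc).supportFunction_eq (h.mem_iff.self_of_nhds.2 hx.le),
    inner_smul_right, mul_pow, inv_pow, div_mul_eq_div_div, div_inv_eq_mul]

lemma continuousOn_centroAffineCurvature (hKc : Convex ℝ K) (hK : IsClosed K)
    (h0 : (0 : EuclideanSpace ℝ (Fin n)) ∈ interior K) (hK2 : HasC2Boundary K) :
    ContinuousOn (centroAffineCurvature K) (frontier K) := by
  intro x hx
  obtain ⟨f, hf⟩ := hK2.exists_isLocalDefiningFunction hx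
  have hc : ContinuousAt
      (fun y => borderedHessian f y / inner ℝ y (gradient f y) ^ (n + 1)) x := by
    have hg : ContinuousAt (gradient f) x := (contDiffAt_gradient hf.contDiffAt).continuousAt
    exact (continuousAt_borderedHessian hf.contDiffAt).div ((continuousAt_id.inner hg).pow _)
      (pow_ne_zero _ (hf.inner_gradient_pos (hf.eq_zero hK hx) hKc h0).ne')
  have heq : centroAffineCurvature K =ᶠ[𝓝[frontier K] x]
      fun y => borderedHessian f y / inner ℝ y (gradient f y) ^ (n + 1) := by
    filter_upwards [self_mem_nhdsWithin, nhdsWithin_le_nhds hf.eventually] with y hy h1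
    exact h1.centroAffineCurvature_eq (h1.eq_zero hK hy) hKc hK
  exact hc.continuousWithinAt.congr_of_eventuallyEq heq (heq.self_of_nhdsWithin hx)

lemma IsC2PlusBody.centroAffineCurvature_pos (hK : IsC2PlusBody K) (hx : x ∈ frontier K) :
    0 < centroAffineCurvature K x := by
  obtain ⟨f, hf⟩ := hK.c2_boundary.exists_isLocalDefiningFunction hx
  have h0 := hf.eq_zero hK.isCompact.isClosed hx
  refine div_pos (hK.gaussCurvature_pos x hx) (pow_pos ?_ _)
  have hn := hf.isOuterUnitNormal h0 hK.convex
  rw [hf.gaussMap_eq h0 hK.convex,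
    hn.supportFunction_eq (hK.isCompact.isClosed.frontier_subset hx)]
  exact hn.inner_pos hK.zero_mem_interior

lemma IsC2PlusBody.continuousOn_centroAffineCurvature (hK : IsC2PlusBody K) :
    ContinuousOn (centroAffineCurvature K) (frontier K) :=
  CentroAffine.continuousOn_centroAffineCurvature hK.convex hK.isCompact.isClosed
    hK.zero_mem_interior hK.c2_boundary

end CentroAffineCurvature

/-! ### Invariance of the centro-affine curvature under `SL(n)` -/

section Invariance

open InnerProductSpace Module ContinuousLinearMap

lemma det_adjoint {E : Type*} [NormedAddCommGroup E] [InnerProductSpace ℝ E]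
    [FiniteDimensional ℝ E] (A : E →L[ℝ] E) :
    LinearMap.det (adjoint A).toLinearMap = LinearMap.det A.toLinearMap := by
  let b := stdOrthonormalBasis ℝ E
  have : (adjoint A).toLinearMap = LinearMap.adjoint A.toLinearMap := by
    rw [LinearMap.eq_adjoint_iff]
    exact fun x y => adjoint_inner_left A y x
  rw [this, ← LinearMap.det_toMatrix b.toBasis, LinearMap.toMatrix_adjoint b b,
    Matrix.det_conjTranspose, LinearMap.det_toMatrix]
  rfl

variable {K : Set (EuclideanSpace ℝ (Fin n))} {f : EuclideanSpace ℝ (Fin n) → ℝ}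
  {x : EuclideanSpace ℝ (Fin n)}

lemma gradient_comp_clm (A : EuclideanSpace ℝ (Fin n) →L[ℝ] EuclideanSpace ℝ (Fin n))
    (hf : DifferentiableAt ℝ f (A x)) :
    gradient (f ∘ A) x = adjoint A (gradient f (A x)) := by
  refine ext_inner_right ℝ fun v => ?_
  rw [inner_gradient_left, adjoint_inner_left, inner_gradient_left,
    fderiv_comp x hf A.differentiableAt, A.fderiv]
  rfl

/-- Under a linear substitution of determinant one, the gradient and the Hessian change by
`g ↦ A* g` and `H ↦ A* H A`, so the bordered Hessian does not change. -/
lemma borderedHessian_comp_clm (A : EuclideanSpace ℝ (Fin n) →L[ℝ] EuclideanSpace ℝ (Fin n))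
    (hA : LinearMap.det A.toLinearMap = 1) (hf : ContDiffAt ℝ 2 f (A x)) :
    borderedHessian (f ∘ A) x = borderedHessian f (A x) := by
  set g := gradient f (A x) with hg
  set H := fderiv ℝ (gradient f) (A x) with hH
  have hgrad : gradient (f ∘ A) =ᶠ[𝓝 x] adjoint A ∘ gradient f ∘ A := by
    filter_upwards [A.continuous.continuousAt.eventually (hf.eventually (by simp))] with y hy
    exact gradient_comp_clm A (hy.differentiableAt (by norm_num))
  have hess : fderiv ℝ (gradient (f ∘ A)) x = (adjoint A) ∘L H ∘L A := by
    rw [hgrad.fderiv_eq]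
    have hd := ((contDiffAt_gradient hf).differentiableAt (by norm_num)).hasFDerivAt
    exact ((adjoint A).hasFDerivAt.comp x (hd.comp x A.hasFDerivAt)).fderiv
  have hone : rankOne ℝ (adjoint A g) (adjoint A g) = (adjoint A) ∘L rankOne ℝ g g ∘L A := by
    ext1 v
    simp [adjoint_inner_left]
  have hdet (B : EuclideanSpace ℝ (Fin n) →L[ℝ] EuclideanSpace ℝ (Fin n)) :
      LinearMap.det ((adjoint A) ∘L B ∘L A).toLinearMap = LinearMap.det B.toLinearMap := by
    rw [toLinearMap_comp, toLinearMap_comp, LinearMap.det_comp, LinearMap.det_comp, det_adjoint,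
      hA, one_mul, mul_one]
  rw [borderedHessian, borderedHessian, hess,
    gradient_comp_clm A (hf.differentiableAt (by norm_num)), ← hg, hone, ← comp_add, ← add_comp, hdet, hdet]

variable (e : EuclideanSpace ℝ (Fin n) ≃L[ℝ] EuclideanSpace ℝ (Fin n))

lemma mem_image_iff_symm_mem {y : EuclideanSpace ℝ (Fin n)} : y ∈ e '' K ↔ e.symm y ∈ K := by
  rw [e.image_eq_preimage_symm]; rfl

lemma frontier_image : frontier (e '' K) = e '' frontier K :=
  (e.toHomeomorph.image_frontier K).symm

lemma IsLocalDefiningFunction.image (h : IsLocalDefiningFunction K f x) :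
    IsLocalDefiningFunction (e '' K) (f ∘ e.symm) (e x) := by
  have hx : e.symm (e x) = x := e.symm_apply_apply x
  have hc : ContDiffAt ℝ 2 f (e.symm (e x)) := by rw [hx]; exact h.contDiffAt
  refine ⟨hc.comp (e x) e.symm.contDiff.contDiffAt, ?_, ?_⟩
  · rw [gradient_ne_zero_iff]
    intro h0
    refine gradient_ne_zero_iff.1 h.gradient_ne_zero ?_
    ext v
    have h1 := congrArg (fun A : EuclideanSpace ℝ (Fin n) →L[ℝ] ℝ => A (e v)) h0
    rw [fderiv_comp (e x) (hc.differentiableAt (by norm_num)) e.symm.differentiableAt,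
      e.symm.fderiv, hx] at h1
    simpa using h1
  · have ht : Tendsto e.symm (𝓝 (e x)) (𝓝 x) := by
      simpa using e.symm.continuous.tendsto (e x)
    filter_upwards [ht.eventually h.mem_iff] with y hy
    rw [mem_image_iff_symm_mem]
    exact hy

variable {e}

lemma IsLocalDefiningFunction.borderedHessian_image
    (he : LinearMap.det (e : EuclideanSpace ℝ (Fin n) →L[ℝ] EuclideanSpace ℝ (Fin n)).toLinearMap
      = 1) (h : IsLocalDefiningFunction K f x) :
    borderedHessian (f ∘ e.symm) (e x) = borderedHessian f x := by
  have he' : LinearMap.det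
      (e.symm : EuclideanSpace ℝ (Fin n) →L[ℝ] EuclideanSpace ℝ (Fin n)).toLinearMap = 1 := by
    have h1 := LinearMap.det_comp
      (e : EuclideanSpace ℝ (Fin n) →L[ℝ] EuclideanSpace ℝ (Fin n)).toLinearMap
      (e.symm : EuclideanSpace ℝ (Fin n) →L[ℝ] EuclideanSpace ℝ (Fin n)).toLinearMap
    rw [← toLinearMap_comp, ContinuousLinearEquiv.coe_comp_coe_symm, he, one_mul] at h1
    rw [← h1]
    exact LinearMap.det_id
  have := borderedHessian_comp_clm (f := f) (x := e x)
    (e.symm : EuclideanSpace ℝ (Fin n) →L[ℝ] EuclideanSpace ℝ (Fin n)) he'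
    (by simpa using h.contDiffAt)
  simpa using this

lemma IsLocalDefiningFunction.inner_gradient_image (h : IsLocalDefiningFunction K f x) :
    inner ℝ (e x) (gradient (f ∘ e.symm) (e x)) = inner ℝ x (gradient f x) := by
  have hd : DifferentiableAt ℝ f ((e.symm : EuclideanSpace ℝ (Fin n) →L[ℝ] _) (e x)) := by
    simpa using h.contDiffAt.differentiableAt (by norm_num)
  have := gradient_comp_clm (e.symm : EuclideanSpace ℝ (Fin n) →L[ℝ] _) hd
  rw [ContinuousLinearEquiv.coe_coe] at this
  rw [this, adjoint_inner_right]
  simp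

lemma IsC2PlusBody.image (hK : IsC2PlusBody K)
    (he : LinearMap.det (e : EuclideanSpace ℝ (Fin n) →L[ℝ] EuclideanSpace ℝ (Fin n)).toLinearMap
      = 1) : IsC2PlusBody (e '' K) := by
  have hconv : Convex ℝ (e '' K) := hK.convex.linear_image e.toLinearEquiv.toLinearMap
  have hcomp : IsCompact (e '' K) := hK.isCompact.image e.continuous
  refine ⟨hconv, hcomp, ?_, ?_, ?_⟩
  · have : interior (e '' K) = e '' interior K := (e.toHomeomorph.image_interior K).symm
    rw [this]
    exact ⟨0, hK.zero_mem_interior, map_zero e⟩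
  · rw [HasC2Boundary, frontier_image]
    rintro _ ⟨x, hx, rfl⟩
    obtain ⟨f, hf⟩ := hK.c2_boundary.exists_isLocalDefiningFunction hx
    have := hf.image e
    exact ⟨_, this.contDiffAt, gradient_ne_zero_iff.1 this.gradient_ne_zero, this.mem_iff⟩
  · rw [frontier_image]
    rintro _ ⟨x, hx, rfl⟩
    obtain ⟨f, hf⟩ := hK.c2_boundary.exists_isLocalDefiningFunction hx
    have hx0 := hf.eq_zero hK.isCompact.isClosed hx
    have hfe := hf.image e
    have h1 := hf.gaussCurvature_mul hx0 hK.convex hK.isCompact.isClosed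
    have h2 := hfe.gaussCurvature_mul (by simpa using hx0) hconv hcomp.isClosed
    rw [hf.borderedHessian_image he, ← h1] at h2
    have hp := norm_pos_iff.2 hf.gradient_ne_zero
    have h3 := mul_pos (hK.gaussCurvature_pos x hx) (pow_pos hp (n + 1))
    rw [← h2] at h3
    exact pos_of_mul_pos_left h3 (by positivity)

lemma IsC2PlusBody.centroAffineCurvature_image (hK : IsC2PlusBody K)
    (he : LinearMap.det (e : EuclideanSpace ℝ (Fin n) →L[ℝ] EuclideanSpace ℝ (Fin n)).toLinearMap
      = 1) (hx : x ∈ frontier K) :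
    centroAffineCurvature (e '' K) (e x) = centroAffineCurvature K x := by
  obtain ⟨f, hf⟩ := hK.c2_boundary.exists_isLocalDefiningFunction hx
  have hx0 := hf.eq_zero hK.isCompact.isClosed hx
  have hKe := hK.image he
  rw [hf.centroAffineCurvature_eq hx0 hK.convex hK.isCompact.isClosed,
    (hf.image e).centroAffineCurvature_eq (by simpa using hx0) hKe.convex hKe.isCompact.isClosed,
    hf.borderedHessian_image he, hf.inner_gradient_image]

end Invariance

/-! ### The cone measure -/

section ConeMeasure

variable {K : Set (EuclideanSpace ℝ (Fin n))}

lemma measurable_radialProjection (hKc : Convex ℝ K)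
    (h0 : (0 : EuclideanSpace ℝ (Fin n)) ∈ interior K) : Measurable (radialProjection K) :=
  (continuous_gauge hKc (mem_interior_iff_mem_nhds.1 h0)).measurable.inv.smul measurable_id

lemma isFiniteMeasure_coneMeasure (hK : IsCompact K) : IsFiniteMeasure (coneMeasure K) := by
  have : IsFiniteMeasure (volume.restrict K) := ⟨by simpa using hK.measure_lt_top⟩
  unfold coneMeasure
  exact Measure.smul_finite _ (by simp)

lemma coneMeasure_univ (hKc : Convex ℝ K) (h0 : (0 : EuclideanSpace ℝ (Fin n)) ∈ interior K) :
    coneMeasure K Set.univ = n * volume K := by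
  rw [coneMeasure, Measure.smul_apply,
    Measure.map_apply (measurable_radialProjection hKc h0) MeasurableSet.univ]
  simp

lemma radialProjection_mem_frontier (hKc : Convex ℝ K) (hK : IsCompact K)
    (h0 : (0 : EuclideanSpace ℝ (Fin n)) ∈ interior K) {x : EuclideanSpace ℝ (Fin n)}
    (hx : x ≠ 0) : radialProjection K x ∈ frontier K := by
  have hn := mem_interior_iff_mem_nhds.1 h0
  have hpos : 0 < gauge K x := (gauge_pos (absorbent_nhds_zero hn)
    ((NormedSpace.isVonNBounded_iff ℝ).2 hK.isBounded)).2 hx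
  rw [← gauge_eq_one_iff_mem_frontier hKc hn, radialProjection,
    gauge_smul_of_nonneg (inv_nonneg.2 hpos.le), smul_eq_mul, inv_mul_cancel₀ hpos.ne']

/-- The cone measure is concentrated on the boundary; in positive dimension the origin, which has
no radial projection, is a null set. -/
lemma coneMeasure_restrict_frontier (hn : n ≠ 0) (hKc : Convex ℝ K) (hK : IsCompact K)
    (h0 : (0 : EuclideanSpace ℝ (Fin n)) ∈ interior K) :
    (coneMeasure K).restrict (frontier K) = coneMeasure K := by
  have : Nonempty (Fin n) := Fin.pos_iff_nonempty.1 (Nat.pos_of_ne_zero hn)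
  refine Measure.restrict_eq_self_of_ae_mem ?_
  refine Measure.ae_smul_measure ?_ _
  refine (ae_map_iff (p := (· ∈ frontier K)) (measurable_radialProjection hKc h0).aemeasurable
    isClosed_frontier.measurableSet).2 (ae_restrict_of_ae ?_)
  filter_upwards [Measure.ae_ne volume (0 : EuclideanSpace ℝ (Fin n))] with x hx
  exact radialProjection_mem_frontier hKc hK h0 hx

lemma gauge_image_apply (e : EuclideanSpace ℝ (Fin n) ≃L[ℝ] EuclideanSpace ℝ (Fin n))
    (x : EuclideanSpace ℝ (Fin n)) : gauge (e '' K) (e x) = gauge K x := by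
  simp only [gauge_def', ← map_smul, e.injective.mem_set_image]

lemma coneMeasure_image {e : EuclideanSpace ℝ (Fin n) ≃L[ℝ] EuclideanSpace ℝ (Fin n)}
    (he : MeasurePreserving e) (hKc : Convex ℝ K)
    (h0 : (0 : EuclideanSpace ℝ (Fin n)) ∈ interior K) :
    coneMeasure (e '' K) = (coneMeasure K).map e := by
  have hm := measurable_radialProjection hKc h0
  have hemb : MeasurableEmbedding e := e.toHomeomorph.measurableEmbedding
  have hr : volume.restrict (e '' K) = (volume.restrict K).map e := by
    rw [← he.map_eq, hemb.restrict_map, Set.preimage_image_eq _ e.injective, he.map_eq]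
  have hcomp : radialProjection (e '' K) ∘ e = e ∘ radialProjection K := by
    ext1 x
    simp [radialProjection, gauge_image_apply]
  have hm' : Measurable (radialProjection (e '' K)) := by
    refine measurable_radialProjection (hKc.linear_image e.toLinearEquiv.toLinearMap) ?_
    have : interior (e '' K) = e '' interior K := (e.toHomeomorph.image_interior K).symm
    rw [this]
    exact ⟨0, h0, map_zero e⟩
  rw [coneMeasure, coneMeasure, hr, Measure.map_map hm' hemb.measurable, hcomp,
    ← Measure.map_map hemb.measurable hm, Measure.map_smul]

end ConeMeasure

/-! ### Invariance of `Λ` -/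

section InvarianceOfLam

lemma exists_continuousLinearEquiv_of_det_eq_one
    {T : EuclideanSpace ℝ (Fin n) →ₗ[ℝ] EuclideanSpace ℝ (Fin n)} (hT : LinearMap.det T = 1) :
    ∃ e : EuclideanSpace ℝ (Fin n) ≃L[ℝ] EuclideanSpace ℝ (Fin n),
      (e : EuclideanSpace ℝ (Fin n) →L[ℝ] EuclideanSpace ℝ (Fin n)).toLinearMap = T :=
  ⟨(LinearMap.equivOfIsUnitDet (f := T) (by simp [hT])).toContinuousLinearEquiv,
    LinearMap.ext fun x => LinearMap.equivOfIsUnitDet_apply _ x⟩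

variable {K : Set (EuclideanSpace ℝ (Fin n))}

lemma IsC2PlusBody.Lam_image (hK : IsC2PlusBody K)
    {e : EuclideanSpace ℝ (Fin n) ≃L[ℝ] EuclideanSpace ℝ (Fin n)}
    (he : LinearMap.det (e : EuclideanSpace ℝ (Fin n) →L[ℝ] EuclideanSpace ℝ (Fin n)).toLinearMap
      = 1) : Lam (e '' K) = Lam K := by
  have hmp : MeasurePreserving e (volume : Measure (EuclideanSpace ℝ (Fin n))) volume := by
    refine ⟨e.continuous.measurable, ?_⟩
    have := Measure.map_linearMap_addHaar_eq_smul_addHaar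
      (volume : Measure (EuclideanSpace ℝ (Fin n))) (he.trans_ne one_ne_zero)
    rw [he] at this
    simpa using this
  have hemb : MeasurableEmbedding e := e.toHomeomorph.measurableEmbedding
  have hvol : volume.real (e '' K) = volume.real K := by
    rw [Measure.real, Measure.real, ← hmp.measure_preimage_emb hemb,
      Set.preimage_image_eq _ e.injective]
  rw [Lam, Lam, hvol, coneMeasure_image hmp hK.convex hK.zero_mem_interior, frontier_image,
    hemb.setIntegral_map, Set.preimage_image_eq _ e.injective]
  congr 2
  exact setIntegral_congr_fun isClosed_frontier.measurableSet fun x hx => by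
    simp only [hK.centroAffineCurvature_image he hx]

end InvarianceOfLam

/-! ### Power means of small negative order -/

/-- For a bounded function `X` on a finite measure space of mass `M`, the powers
`(M⁻¹ ∫ e ^ (-X / (N - 1))) ^ N` tend to the reciprocal of the geometric mean of `e ^ X`: the
Laplace transform of `X` has the expansion `M - s ∫ X + o(s)` at `0`. -/
lemma tendsto_integral_exp_div_pow {Ω : Type*} [MeasurableSpace Ω] {μ : Measure Ω}
    [IsFiniteMeasure μ] {X : Ω → ℝ} {a b M : ℝ} (hX : AEMeasurable X μ)
    (hb : ∀ᵐ ω ∂μ, X ω ∈ Set.Icc a b) (hM : μ.real Set.univ = M) (hM0 : M ≠ 0) :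
    Tendsto (fun N : ℕ => ((∫ ω, Real.exp (-(N - 1 : ℝ)⁻¹ * X ω) ∂μ) / M) ^ N) atTop
      (𝓝 (Real.exp (-(1 / M * ∫ ω, X ω ∂μ)))) := by
  have hset : ProbabilityTheory.integrableExpSet X μ = Set.univ :=
    Set.eq_univ_of_forall fun t => ProbabilityTheory.integrable_exp_mul_of_mem_Icc hX hb
  have hd : HasDerivAt (ProbabilityTheory.mgf X μ) (∫ ω, X ω ∂μ) 0 := by
    simpa using ProbabilityTheory.hasDerivAt_mgf (X := X) (μ := μ) (t := 0) (by simp [hset])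
  have hN : Tendsto (fun N : ℕ => (N - 1 : ℝ)) atTop atTop :=
    tendsto_atTop_add_const_right _ (-1) tendsto_natCast_atTop_atTop
  have hs : Tendsto (fun N : ℕ => -(N - 1 : ℝ)⁻¹) atTop (𝓝[≠] 0) := by
    refine tendsto_nhdsWithin_iff.2 ⟨by simpa using hN.inv_tendsto_atTop.neg, ?_⟩
    filter_upwards [hN.eventually_gt_atTop 0] with N h
    simpa using h.ne'
  have hslope := (hasDerivAt_iff_tendsto_slope_zero.1 hd).comp hs
  have hratio : Tendsto (fun N : ℕ => (N : ℝ) * (N - 1 : ℝ)⁻¹) atTop (𝓝 1) := by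
    have h1 : Tendsto (fun N : ℕ => 1 + (N - 1 : ℝ)⁻¹) atTop (𝓝 (1 + 0)) :=
      hN.inv_tendsto_atTop.const_add 1
    rw [add_zero] at h1
    refine h1.congr' ?_
    filter_upwards [hN.eventually_gt_atTop 0] with N h
    field_simp
    ring
  have h0 : ProbabilityTheory.mgf X μ 0 = M := by simp [ProbabilityTheory.mgf, hM]
  have hlim : Tendsto (fun N : ℕ => (N : ℝ) *
      ((∫ ω, Real.exp (-(N - 1 : ℝ)⁻¹ * X ω) ∂μ) / M - 1)) atTop
      (𝓝 (-(1 / M * ∫ ω, X ω ∂μ))) := by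
    have h2 := ((hratio.mul hslope).mul_const M⁻¹).neg
    rw [show -(1 / M * ∫ ω, X ω ∂μ) = -(1 * (∫ ω, X ω ∂μ) * M⁻¹) by ring]
    refine h2.congr' ?_
    filter_upwards [hN.eventually_gt_atTop 0] with N h
    simp only [Function.comp_apply, zero_add, h0, smul_eq_mul]
    change _ = (N : ℝ) * (ProbabilityTheory.mgf X μ (-(N - 1 : ℝ)⁻¹) / M - 1)
    field_simp
  simpa using Real.tendsto_one_add_pow_exp_of_tendsto hlim

/-! ### Convergence of the affine surface areas -/

section Limit

variable {K : Set (EuclideanSpace ℝ (Fin n))}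

lemma IsC2PlusBody.integrableOn_of_continuousOn (hK : IsC2PlusBody K)
    {F : EuclideanSpace ℝ (Fin n) → ℝ} (hF : ContinuousOn F (frontier K)) :
    IntegrableOn F (frontier K) (coneMeasure K) := by
  have := isFiniteMeasure_coneMeasure hK.isCompact
  exact hF.integrableOn_compact
    (hK.isCompact.of_isClosed_subset isClosed_frontier hK.isCompact.isClosed.frontier_subset)

lemma IsC2PlusBody.continuousOn_log (hK : IsC2PlusBody K) :
    ContinuousOn (fun x => Real.log (centroAffineCurvature K x)) (frontier K) :=
  hK.continuousOn_centroAffineCurvature.log fun _ hx => (hK.centroAffineCurvature_pos hx).ne'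

lemma IsC2PlusBody.coneMeasure_real_univ (hn : n ≠ 0) (hK : IsC2PlusBody K) :
    ((coneMeasure K).restrict (frontier K)).real Set.univ = n * volume.real K := by
  rw [coneMeasure_restrict_frontier hn hK.convex hK.isCompact hK.zero_mem_interior, Measure.real,
    coneMeasure_univ hK.convex hK.zero_mem_interior]
  simp [Measure.real]

lemma IsC2PlusBody.volume_real_pos (hK : IsC2PlusBody K) : 0 < volume.real K :=
  ENNReal.toReal_pos (Measure.measure_pos_of_nonempty_interior _ ⟨0, hK.zero_mem_interior⟩).ne'
    hK.isCompact.measure_lt_top.ne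

lemma IsC2PlusBody.tendsto_affineSurfaceArea (hn : n ≠ 0) (hK : IsC2PlusBody K) :
    Tendsto (fun p : ℕ => (affineSurfaceArea (-(n : ℝ) / 2 ^ p) K /
      (n * volume.real K)) ^ (2 ^ p)) atTop (𝓝 (Lam K)⁻¹) := by
  have := isFiniteMeasure_coneMeasure hK.isCompact
  have hn' : (n : ℝ) ≠ 0 := Nat.cast_ne_zero.2 hn
  have hfr : IsCompact (frontier K) :=
    hK.isCompact.of_isClosed_subset isClosed_frontier hK.isCompact.isClosed.frontier_subset
  obtain ⟨C, hC⟩ := hfr.exists_bound_of_continuousOn hK.continuousOn_log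
  have hb : ∀ᵐ x ∂((coneMeasure K).restrict (frontier K)),
      Real.log (centroAffineCurvature K x) ∈ Set.Icc (-C) C := by
    filter_upwards [ae_restrict_mem isClosed_frontier.measurableSet] with x hx
    exact abs_le.1 (hC x hx)
  have hlim := (tendsto_integral_exp_div_pow
    (hK.continuousOn_log.aemeasurable isClosed_frontier.measurableSet) hb
    (hK.coneMeasure_real_univ hn) (mul_ne_zero hn' hK.volume_real_pos.ne')).comp
    (tendsto_pow_atTop_atTop_of_one_lt (one_lt_two (α := ℕ)))
  rw [Lam, ← Real.exp_neg]
  refine hlim.congr' ?_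
  filter_upwards [eventually_ge_atTop 1] with p hp
  -- with `q = -n / N` the exponent `q / (n + q)` is `-1 / (N - 1)`
  have hexp : (-(n : ℝ) / 2 ^ p) / (n + -(n : ℝ) / 2 ^ p) = -(2 ^ p - 1 : ℝ)⁻¹ := by
    have h1 : (1 : ℝ) < 2 ^ p := one_lt_pow₀ one_lt_two (by omega)
    have h2 : (2 ^ p - 1 : ℝ) ≠ 0 := (sub_pos.2 h1).ne'
    have h3 : (n : ℝ) + -(n : ℝ) / 2 ^ p = n * (2 ^ p - 1) / 2 ^ p := by
      field_simp
      ring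
    rw [h3]
    field_simp
  simp only [Function.comp_apply, affineSurfaceArea, hexp, Nat.cast_pow, Nat.cast_ofNat]
  congr 2
  refine setIntegral_congr_fun isClosed_frontier.measurableSet fun x hx => ?_
  simp only [Real.rpow_def_of_pos (hK.centroAffineCurvature_pos hx), mul_comm]

end Limit

end CentroAffine

end

theorem mainTheorem10 (n : ℕ) (hn : 2 ≤ n) (K : Set (EuclideanSpace ℝ (Fin n)))
    (hK : CentroAffine.IsC2PlusBody K) :
    -- the integral that defines `Λ(K)` converges
    IntegrableOn (fun x => Real.log (CentroAffine.centroAffineCurvature K x)) (frontier K)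
      (CentroAffine.coneMeasure K) ∧
    -- `Λ` is an `SL(n)`-invariant
    (∀ T : EuclideanSpace ℝ (Fin n) →ₗ[ℝ] EuclideanSpace ℝ (Fin n), LinearMap.det T = 1 →
      CentroAffine.IsC2PlusBody (T '' K) ∧
        CentroAffine.Lam (T '' K) = CentroAffine.Lam K) ∧
    -- the integrals that define the terms of the sequence converge
    (∀ p : ℕ, 1 < p →
      IntegrableOn (fun x => CentroAffine.centroAffineCurvature K x ^
        ((-(n : ℝ) / 2 ^ p) / (n + -(n : ℝ) / 2 ^ p))) (frontier K)
        (CentroAffine.coneMeasure K)) ∧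
    -- the sequence converges to the reciprocal of `Λ(K)`
    Tendsto (fun p : ℕ => (CentroAffine.affineSurfaceArea (-(n : ℝ) / 2 ^ p) K /
      (n * volume.real K)) ^ (2 ^ p)) atTop (𝓝 (CentroAffine.Lam K)⁻¹) := by
  refine ⟨hK.integrableOn_of_continuousOn hK.continuousOn_log, fun T hT => ?_, fun p _ => ?_,
    hK.tendsto_affineSurfaceArea (by omega)⟩
  · obtain ⟨e, he⟩ := CentroAffine.exists_continuousLinearEquiv_of_det_eq_one hT
    have himage : T '' K = e '' K := by rw [← he]; rfl
    rw [← he] at hT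
    rw [himage]
    exact ⟨hK.image hT, hK.Lam_image hT⟩
  · exact hK.integrableOn_of_continuousOn (hK.continuousOn_centroAffineCurvature.rpow_const
      fun x hx => Or.inl (hK.centroAffineCurvature_pos hx).ne')
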